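/- Conventions: for a real random variable $Y$, $\|Y\|_{\psi_2}=\inf\{K>0:\mathbb E\,e^{Y^2/K^2}\le 2\}$ (with $\inf\emptyset=\infty$), and for a random vector $x\in\mathbb R^d$, $\|x\|_{\psi_2}=\sup_{\|u\|_2=1}\|\langle x,u\rangle\|_{\psi_2}$. For a function $\sigma:\mathbb R\to\mathbb R$, applied entrywise to vectors, and a matrix $X\in\mathbb R^{N\times d}$, let $$G_*=\mathbb E_{w\sim\mathcal N(0,\frac1d I_d)}\big[\sigma(Xw)\,\sigma(Xw)^T\big]\in\mathbb R^{N\times N},\qquad \lambda_*=\lambda_{\min}(G_*),$$ where $\lambda_{\min}$ denotes the smallest eigenvalue. Theorem. Let $c_1>0$ be a constant and let $\sigma:\mathbb R\to\mathbb R$ satisfy: (i) $\sigma\in L^2(\mathbb R,e^{-x^2/2}/\sqrt{2\pi})$; (ii) $\sigma$ is not linear as an element of this space, i.e. there is no $a\in\mathbb R$ with $\sigma(x)=ax$ for Lebesgue-almost every $x$; (iii) $|\sigma(x)|\le|x|$ for every $x\in\mathbb R$. Then there is a constant $c_2>0$, depending only on $c_1$ and $\sigma$, and for every integer $k\ge2$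 there is a constant $b_1>0$, depending only on $c_1$, $\sigma$ and $k$, such that the following holds. For all integers $N\ge1$ and $d$ with $N\le d^k$, and for every random matrix $X=[x_1,\dots,x_N]^T\in\mathbb R^{N\times d}$ whose rows are i.i.d. random vectors with $\|x_i\|_2=\sqrt d$ almost surely and $\|x_i\|_{\psi_2}\le c_1$ for all $i$, $$\mathbb P\big(\lambda_*\ge b_1\big)\ \ge\ 1-2N^2\exp\!\big(-c_2N^{4/(5k)}\big).$$ -/

import Mathlib

open MeasureTheory ProbabilityTheory
open scoped ENNReal Matrix

noncomputable section

/-- The sub-Gaussian (`ψ₂`) norm of a real random variable `Y` under `P`: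
`‖Y‖_{ψ₂} = inf {K > 0 : E exp (Y² / K²) ≤ 2}`, with value `∞` if there is no such `K`. -/
def psi2Norm {Ω : Type*} [MeasurableSpace Ω] (P : Measure Ω) (Y : Ω → ℝ) : ℝ≥0∞ :=
  ⨅ (K : ℝ) (_ : 0 < K ∧ ∫⁻ ω, ENNReal.ofReal (Real.exp (Y ω ^ 2 / K ^ 2)) ∂P ≤ 2),
    ENNReal.ofReal K

/-- The sub-Gaussian (`ψ₂`) norm of a random vector `x` in `ℝᵈ` under `P`:
`‖x‖_{ψ₂} = sup_{‖u‖₂ = 1} ‖⟨x, u⟩‖_{ψ₂}`. The vector is sub-Gaussian iff this is finite. -/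
def vectorPsi2Norm {Ω : Type*} [MeasurableSpace Ω] (P : Measure Ω) {d : ℕ}
    (x : Ω → EuclideanSpace ℝ (Fin d)) : ℝ≥0∞ :=
  ⨆ (u : EuclideanSpace ℝ (Fin d)) (_ : ‖u‖ = 1), psi2Norm P fun ω => inner ℝ (x ω) u

/-- The matrix `X = [x₁, …, x_N]ᵀ ∈ ℝ^{N × d}` whose `i`-th row is `xᵢ`. -/
def dataMatrix {N d : ℕ} (x : Fin N → EuclideanSpace ℝ (Fin d)) : Matrix (Fin N) (Fin d) ℝ :=
  Matrix.of fun i j => x i j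

/-- The expected Gram matrix `G_* = E[σ(Xw) σ(Xw)ᵀ]` for `w ∼ N(0, I_d / d)`, with `σ` applied
entrywise and the expectation taken entrywise. -/
def expectedGram (σ : ℝ → ℝ) {N d : ℕ} (X : Matrix (Fin N) (Fin d) ℝ) :
    Matrix (Fin N) (Fin N) ℝ :=
  Matrix.of fun i j =>
    ∫ w, Matrix.vecMulVec (fun l => σ ((X *ᵥ WithLp.ofLp w) l))
        (fun l => σ ((X *ᵥ WithLp.ofLp w) l)) i j
      ∂(multivariateGaussian (0 : EuclideanSpace ℝ (Fin d))
        ((d : ℝ)⁻¹ • (1 : Matrix (Fin d) (Fin d) ℝ)))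

/-- The smallest eigenvalue of a real symmetric matrix `A` of positive size
(its spectrum is then finite and non-empty, so the infimum is a minimum). -/
def minEigenvalue {N : ℕ} (A : Matrix (Fin N) (Fin N) ℝ) : ℝ :=
  sInf (spectrum ℝ A)

/-- `λ_*`, the smallest eigenvalue of the expected Gram matrix `G_*`. -/
def lambdaStar (σ : ℝ → ℝ) {N d : ℕ} (X : Matrix (Fin N) (Fin d) ℝ) : ℝ :=
  minEigenvalue (expectedGram σ X)

end

/-! Write `m r` for the integral of `σ` against the `r`-th Hermite polynomial under the standard
Gaussian. Formally `G_* = Σ_r (m r)² / r! · R^{∘r}`, where `R i j = ⟨x i, x j⟩ / d` and `∘r` is the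
entrywise power. Every summand is positive semidefinite, so `G_*` dominates any single one; only
this Bessel-type bound is needed (`sum_sum_inner_pow_le_expectedGram`), and it rests on the Mehler
identity.

The matrix `R^{∘r}` has unit diagonal. If its off-diagonal entries are at most `1 / (2N)` in
absolute value, it is at least `1/2` as a quadratic form, whence `λ_* ≥ (m r)² / (2 r!)`. By
independence and the sub-Gaussian tail, `|R i j| ≥ τ` has probability at most `2 exp(-τ² d / (2
c₁²))`, and a union bound runs over the pairs. Taking `τ = (2N)^(-1/r)` with `r ≥ 10k`, and `d ≥
N^(1/k)`, gives `τ² d ≥ N^(4/(5k)) / 2`.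

Some `r ≥ 10k` has `m r ≠ 0`: otherwise completeness of the Hermite system makes `σ` a.e. a
polynomial, and the bound `|σ t| ≤ |t|` forces that polynomial to be linear. This `r` depends only
on `σ` and `k`, hence so does the eigenvalue bound. -/

/-! ### Hermite polynomials: orthogonality and the Mehler identity -/

theorem integrable_eval_gaussianReal (p : Polynomial ℝ) :
    Integrable (fun t => p.eval t) (gaussianReal 0 1) := by
  induction p using Polynomial.induction_on' with
  | add p q hp hq =>
    simp only [Polynomial.eval_add]
    exact hp.add hq
  | monomial n a =>
    simp only [Polynomial.eval_monomial]
    refine Integrable.const_mul ?_ a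
    have h := (memLp_id_gaussianReal (μ := 0) (v := 1) (n : NNReal)).integrable_norm_pow'
    refine h.mono' (by fun_prop) (Filter.Eventually.of_forall fun t => ?_)
    simp

theorem memLp_eval_gaussianReal (p : Polynomial ℝ) :
    MemLp (fun t => p.eval t) 2 (gaussianReal 0 1) := by
  refine (memLp_two_iff_integrable_sq (by fun_prop)).2 ?_
  exact (integrable_eval_gaussianReal (p ^ 2)).congr
    (Filter.Eventually.of_forall fun t => Polynomial.eval_pow 2)

/-- Stein's identity for polynomials. -/
theorem integral_eval_X_mul_gaussianReal (p : Polynomial ℝ) :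
    ∫ t, (Polynomial.X * p).eval t ∂gaussianReal 0 1
      = ∫ t, p.derivative.eval t ∂gaussianReal 0 1 := by
  have hint : ∀ q : Polynomial ℝ,
      Integrable (fun t => q.eval t * gaussianPDFReal 0 1 t) volume := by
    intro q
    have h := integrable_eval_gaussianReal q
    rw [gaussianReal_of_var_ne_zero 0 one_ne_zero,
      integrable_withDensity_iff (measurable_gaussianPDF 0 1)
        (Filter.Eventually.of_forall fun _ => gaussianPDF_lt_top)] at h
    simpa [toReal_gaussianPDF] using h
  have hderiv : ∀ t, HasDerivAt (gaussianPDFReal 0 1) (-t * gaussianPDFReal 0 1 t) t := by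
    intro t
    have h1 : HasDerivAt (fun t : ℝ => -t ^ 2 / 2) (-t) t := by
      have := ((hasDerivAt_pow 2 t).neg).div_const 2
      convert! this using 1
      push_cast
      ring
    have h2 := (h1.exp).const_mul ((√(2 * Real.pi * 1))⁻¹)
    have e : gaussianPDFReal 0 1 = fun t => (√(2 * Real.pi * 1))⁻¹ * Real.exp (-t ^ 2 / 2) := by
      ext s; simp [gaussianPDFReal]
    rw [e]
    convert! h2 using 1
    ring
  have key := integral_mul_deriv_eq_deriv_mul_of_integrable (u := fun t => p.eval t)
    (u' := fun t => p.derivative.eval t) (v := gaussianPDFReal 0 1)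
    (v' := fun t => -t * gaussianPDFReal 0 1 t)
    (fun t _ => p.hasDerivAt t) (fun t _ => hderiv t)
    (by
      refine ((hint (Polynomial.X * p)).neg).congr (Filter.Eventually.of_forall fun t => ?_)
      simp; ring)
    (hint _) (hint p)
  rw [integral_gaussianReal_eq_integral_smul one_ne_zero,
    integral_gaussianReal_eq_integral_smul one_ne_zero]
  calc ∫ t, gaussianPDFReal 0 1 t • (Polynomial.X * p).eval t
      = -∫ t, p.eval t * (-t * gaussianPDFReal 0 1 t) := by
        rw [← integral_neg]; congr 1; ext t; simp; ring
    _ = ∫ t, p.derivative.eval t * gaussianPDFReal 0 1 t := by rw [key, neg_neg]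
    _ = _ := by congr 1; ext t; simp [mul_comm]

/-- The probabilists' Hermite polynomials with real coefficients. -/
noncomputable def realHermite (n : ℕ) : Polynomial ℝ :=
  (Polynomial.hermite n).map (Int.castRingHom ℝ)

theorem realHermite_zero : realHermite 0 = 1 := by
  simp [realHermite]

theorem realHermite_succ (n : ℕ) :
    realHermite (n + 1) = Polynomial.X * realHermite n - (realHermite n).derivative := by
  simp [realHermite, Polynomial.hermite_succ, Polynomial.derivative_map]

theorem realHermite_monic (n : ℕ) : (realHermite n).Monic :=
  (Polynomial.hermite_monic n).map _

theorem natDegree_realHermite (n : ℕ) : (realHermite n).natDegree = n := by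
  rw [realHermite, (Polynomial.hermite_monic n).natDegree_map, Polynomial.natDegree_hermite]

theorem derivative_realHermite_succ (n : ℕ) :
    (realHermite (n + 1)).derivative = ((n : Polynomial ℝ) + 1) * realHermite n := by
  induction n with
  | zero => simp [realHermite_succ, realHermite_zero]
  | succ n ih =>
    rw [realHermite_succ (n + 1), Polynomial.derivative_sub, Polynomial.derivative_mul, ih]
    have h := realHermite_succ n
    have h2 : (((n : Polynomial ℝ) + 1) * realHermite n).derivative
        = ((n : Polynomial ℝ) + 1) * (realHermite n).derivative := by
      simp [Polynomial.derivative_mul]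
    rw [h2]
    push_cast
    simp only [Polynomial.derivative_X]
    linear_combination (-(n : Polynomial ℝ) - 1) * h

/-- By Stein's identity `q ↦ X q - q'` is adjoint to differentiation, and `realHermite n` is its
`n`-th iterate applied to `1`. Both orthogonality and the normalisation `n!` follow by taking `p` to
be a Hermite polynomial. -/
theorem integral_mul_realHermite (n : ℕ) (p : Polynomial ℝ) :
    ∫ t, (p * realHermite n).eval t ∂gaussianReal 0 1
      = ∫ t, (Polynomial.derivative^[n] p).eval t ∂gaussianReal 0 1 := by
  induction n generalizing p with
  | zero => simp [realHermite_zero]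
  | succ n ih =>
    rw [Function.iterate_succ_apply, ← ih]
    have e : p * realHermite (n + 1)
        = Polynomial.X * (p * realHermite n) - p * (realHermite n).derivative := by
      rw [realHermite_succ]; ring
    simp only [e, Polynomial.eval_sub]
    rw [integral_sub (integrable_eval_gaussianReal _) (integrable_eval_gaussianReal _),
      integral_eval_X_mul_gaussianReal, Polynomial.derivative_mul]
    simp only [Polynomial.eval_add]
    rw [integral_add (integrable_eval_gaussianReal _) (integrable_eval_gaussianReal _)]
    ring

theorem integral_realHermite_mul_of_lt {m n : ℕ} (h : m < n) :
    ∫ t, (realHermite m).eval t * (realHermite n).eval t ∂gaussianReal 0 1 = 0 := by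
  have := integral_mul_realHermite n (realHermite m)
  rw [Polynomial.iterate_derivative_eq_zero (by rwa [natDegree_realHermite])] at this
  simpa using this

theorem integral_realHermite_mul_self (n : ℕ) :
    ∫ t, (realHermite n).eval t * (realHermite n).eval t ∂gaussianReal 0 1 = n.factorial := by
  have := integral_mul_realHermite n (realHermite n)
  have h2 : Polynomial.derivative^[n] (realHermite n) = Polynomial.C (n.factorial : ℝ) := by
    have hd : (Polynomial.derivative^[n] (realHermite n)).natDegree = 0 := by
      have := Polynomial.natDegree_iterate_derivative (realHermite n) n
      rw [natDegree_realHermite] at this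
      omega
    rw [Polynomial.eq_C_of_natDegree_eq_zero hd, Polynomial.coeff_iterate_derivative]
    have h1 : (realHermite n).coeff n = 1 := by
      have := (realHermite_monic n).coeff_natDegree
      rwa [natDegree_realHermite] at this
    simp [h1, Nat.descFactorial_self]
  rw [h2] at this
  simpa using this

theorem integral_realHermite_mul_of_ne {m n : ℕ} (h : m ≠ n) :
    ∫ t, (realHermite m).eval t * (realHermite n).eval t ∂gaussianReal 0 1 = 0 := by
  rcases lt_or_gt_of_ne h with h | h
  · exact integral_realHermite_mul_of_lt h
  · simpa only [mul_comm] using integral_realHermite_mul_of_lt h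

/-- Hermite polynomials are eigenfunctions of the Ornstein–Uhlenbeck (Mehler) semigroup. -/
theorem integral_realHermite_mehler {ρ s : ℝ} (h : ρ ^ 2 + s ^ 2 = 1) (n : ℕ) (x : ℝ) :
    ∫ y, (realHermite n).eval (ρ * x + s * y) ∂gaussianReal 0 1
      = ρ ^ n * (realHermite n).eval x := by
  set ℓ : Polynomial ℝ := Polynomial.C (ρ * x) + Polynomial.C s * Polynomial.X with hℓ
  have hev : ∀ (p : Polynomial ℝ) (y : ℝ), p.eval (ρ * x + s * y) = (p.comp ℓ).eval y := by
    intro p y; simp [hℓ, Polynomial.eval_comp]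
  have hint : ∀ p : Polynomial ℝ,
      Integrable (fun y => p.eval (ρ * x + s * y)) (gaussianReal 0 1) := by
    intro p; simp only [hev]; exact integrable_eval_gaussianReal _
  -- Stein's identity in `y`, applied to `p.comp ℓ`, produces `s² p'`; then `s² - 1 = -ρ²`. With
  -- `derivative_realHermite_succ` this turns the Hermite recursion into one for the averages.
  have step : ∀ p : Polynomial ℝ,
      ∫ y, (Polynomial.X * p - p.derivative).eval (ρ * x + s * y) ∂gaussianReal 0 1
        = ρ * x * ∫ y, p.eval (ρ * x + s * y) ∂gaussianReal 0 1
          - ρ ^ 2 * ∫ y, p.derivative.eval (ρ * x + s * y) ∂gaussianReal 0 1 := by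
    intro p
    have hs : ∫ y, y * p.eval (ρ * x + s * y) ∂gaussianReal 0 1
        = s * ∫ y, p.derivative.eval (ρ * x + s * y) ∂gaussianReal 0 1 := by
      have := integral_eval_X_mul_gaussianReal (p.comp ℓ)
      have hd : (p.comp ℓ).derivative = Polynomial.C s * p.derivative.comp ℓ := by
        rw [Polynomial.derivative_comp]; simp [hℓ]
      rw [hd] at this
      simp only [Polynomial.eval_mul, Polynomial.eval_X, Polynomial.eval_C, ← hev] at this
      rw [this, integral_const_mul]
    have hi : Integrable (fun y => y * p.eval (ρ * x + s * y)) (gaussianReal 0 1) := by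
      have := integrable_eval_gaussianReal (Polynomial.X * p.comp ℓ)
      simpa only [Polynomial.eval_mul, Polynomial.eval_X, ← hev] using this
    have e : (fun y => (Polynomial.X * p - p.derivative).eval (ρ * x + s * y))
        = fun y => (ρ * x * p.eval (ρ * x + s * y) + s * (y * p.eval (ρ * x + s * y)))
          - p.derivative.eval (ρ * x + s * y) := by
      ext y; simp; ring
    have hi' : Integrable (fun y => ρ * x * p.eval (ρ * x + s * y)
        + s * (y * p.eval (ρ * x + s * y))) (gaussianReal 0 1) :=
      ((hint p).const_mul _).add (hi.const_mul s)
    rw [e, integral_sub hi' (hint _),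
      integral_add ((hint p).const_mul _) (hi.const_mul s), integral_const_mul,
      integral_const_mul, hs]
    linear_combination (∫ y, p.derivative.eval (ρ * x + s * y) ∂gaussianReal 0 1) * h
  induction n using Nat.strong_induction_on with
  | _ n ih =>
    match n with
    | 0 => simp [realHermite_zero]
    | 1 =>
      have := step 1
      simpa [realHermite_succ, realHermite_zero] using this
    | n + 2 =>
      rw [realHermite_succ (n + 1), step, ih (n + 1) (by omega), derivative_realHermite_succ]
      have hc : ∀ z : ℝ, (((n : Polynomial ℝ) + 1) * realHermite n).eval z
          = ((n : ℝ) + 1) * (realHermite n).eval z := by intro z; simp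
      simp only [Polynomial.eval_sub, hc]
      rw [integral_const_mul, ih n (by omega)]
      simp only [Polynomial.eval_mul, Polynomial.eval_X]
      ring

/-! ### Completeness of the Hermite polynomials -/

/-- Provides the dominating function for expanding `exp(itx)` termwise under the integral. -/
theorem MemLp.integrable_mul_exp_abs_gaussianReal {f : ℝ → ℝ} (hf : MemLp f 2 (gaussianReal 0 1))
    (t : ℝ) : Integrable (fun x => f x * Real.exp (t * |x|)) (gaussianReal 0 1) := by
  have h : MemLp (fun x : ℝ => Real.exp (t * |x|)) 2 (gaussianReal 0 1) := by
    refine (memLp_two_iff_integrable_sq (by fun_prop)).2 ?_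
    have h1 := (integrable_exp_mul_gaussianReal (μ := 0) (v := 1) (2 * t)).add
      (integrable_exp_mul_gaussianReal (μ := 0) (v := 1) (-(2 * t)))
    refine h1.mono' (by fun_prop) (Filter.Eventually.of_forall fun x => ?_)
    rw [Real.norm_of_nonneg (by positivity), ← Real.exp_nat_mul]
    simp only [Pi.add_apply]
    rcases abs_cases x with ⟨hx, _⟩ | ⟨hx, _⟩
    · rw [hx, show ((2 : ℕ) : ℝ) * (t * x) = 2 * t * x by push_cast; ring]
      linarith [Real.exp_pos (-(2 * t) * x)]
    · rw [hx, show ((2 : ℕ) : ℝ) * (t * -x) = -(2 * t) * x by push_cast; ring]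
      linarith [Real.exp_pos (2 * t * x)]
  exact hf.integrable_mul h

/-- A square-integrable function against the Gaussian measure with vanishing moments has vanishing
Fourier transform. -/
theorem integral_mul_cexp_eq_zero_of_moments {f : ℝ → ℝ} (hf : MemLp f 2 (gaussianReal 0 1))
    (h0 : ∀ n : ℕ, ∫ x, f x * x ^ n ∂gaussianReal 0 1 = 0) (t : ℝ) :
    ∫ x, (f x : ℂ) * Complex.exp (t * x * Complex.I) ∂gaussianReal 0 1 = 0 := by
  set F : ℕ → ℝ → ℂ := fun n x =>
    (f x : ℂ) * ((t * x * Complex.I) ^ n / (n.factorial : ℂ)) with hF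
  have hnorm : ∀ n x, ‖F n x‖ = |f x| * ((|t| * |x|) ^ n / n.factorial) := by
    intro n x
    simp [hF, mul_pow]
  have hsum : ∀ x, HasSum (fun n => (|t| * |x|) ^ n / n.factorial) (Real.exp (|t| * |x|)) := by
    intro x
    rw [Real.exp_eq_exp_ℝ]
    exact NormedSpace.expSeries_div_hasSum_exp (|t| * |x|)
  have hmeas : ∀ n, AEStronglyMeasurable (F n) (gaussianReal 0 1) := by
    intro n
    exact (Complex.continuous_ofReal.comp_aestronglyMeasurable hf.1).mul (by fun_prop)
  have key : HasSum (fun n => ∫ x, F n x ∂gaussianReal 0 1)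
      (∫ x, (f x : ℂ) * Complex.exp (t * x * Complex.I) ∂gaussianReal 0 1) := by
    refine hasSum_integral_of_dominated_convergence
      (fun n x => |f x| * ((|t| * |x|) ^ n / n.factorial)) hmeas
      (fun n => Filter.Eventually.of_forall fun x => (hnorm n x).le)
      (Filter.Eventually.of_forall fun x => ((hsum x).summable.mul_left _)) ?_
      (Filter.Eventually.of_forall fun x => ?_)
    · refine (MemLp.integrable_mul_exp_abs_gaussianReal hf |t|).abs.congr
        (Filter.Eventually.of_forall fun x => ?_)
      simp only
      rw [tsum_mul_left, (hsum x).tsum_eq, abs_mul, Real.abs_exp]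
    · refine HasSum.mul_left _ ?_
      rw [Complex.exp_eq_exp_ℂ]
      exact NormedSpace.expSeries_div_hasSum_exp (_ : ℂ)
  have hz : ∀ n, ∫ x, F n x ∂gaussianReal 0 1 = 0 := by
    intro n
    have e : F n = fun x => ((t : ℂ) * Complex.I) ^ n / (n.factorial : ℂ)
        * ((f x * x ^ n : ℝ) : ℂ) := by
      ext x; simp only [hF]; push_cast; ring
    rw [e, integral_const_mul, integral_complex_ofReal, h0 n]
    simp
  simp only [hz] at key
  exact key.unique hasSum_zero

/-- A real integrable function is a.e. zero if its Fourier transform vanishes. -/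
theorem ae_eq_zero_of_integral_mul_cexp_eq_zero {μ : Measure ℝ} [SFinite μ] {f : ℝ → ℝ}
    (hf : Integrable f μ)
    (h0 : ∀ t : ℝ, ∫ x, (f x : ℂ) * Complex.exp (t * x * Complex.I) ∂μ = 0) :
    f =ᵐ[μ] 0 := by
  -- The positive and negative parts of `f` are densities of two finite measures whose
  -- characteristic functions agree, so the measures agree.
  set ν₁ := μ.withDensity fun x => ENNReal.ofReal (f x)
  set ν₂ := μ.withDensity fun x => ENNReal.ofReal (-f x)
  have hm := hf.1.aemeasurable
  have hm' : AEMeasurable (fun x => -f x) μ := hm.neg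
  have hfin₁ : ∫⁻ x, ENNReal.ofReal (f x) ∂μ ≠ ∞ := hf.lintegral_lt_top.ne
  have hfin₂ : ∫⁻ x, ENNReal.ofReal (-f x) ∂μ ≠ ∞ := hf.neg.lintegral_lt_top.ne
  have : IsFiniteMeasure ν₁ := isFiniteMeasure_withDensity hfin₁
  have : IsFiniteMeasure ν₂ := isFiniteMeasure_withDensity hfin₂
  have hint : ∀ {g : ℝ → ℝ}, Integrable g μ → ∀ t : ℝ,
      Integrable (fun x => (g x : ℂ) * Complex.exp (t * x * Complex.I)) μ := by
    intro g hg t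
    refine (hg.ofReal (𝕜 := ℂ)).mul_bdd (c := 1) (by fun_prop)
      (Filter.Eventually.of_forall fun x => ?_)
    rw [show (t : ℂ) * x * Complex.I = ((t * x : ℝ) : ℂ) * Complex.I by push_cast; ring,
      Complex.norm_exp_ofReal_mul_I]
  have hν : ν₁ = ν₂ := by
    apply Measure.ext_of_charFun
    ext t
    rw [charFun_apply_real, charFun_apply_real,
      integral_withDensity_eq_integral_toReal_smul₀ hm.ennreal_ofReal
        (Filter.Eventually.of_forall fun _ => ENNReal.ofReal_lt_top),
      integral_withDensity_eq_integral_toReal_smul₀ hm'.ennreal_ofReal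
        (Filter.Eventually.of_forall fun _ => ENNReal.ofReal_lt_top), ← sub_eq_zero]
    simp only [Complex.real_smul]
    rw [← integral_sub (hint (g := fun x => (ENNReal.ofReal (f x)).toReal) ?_ t)
      (hint (g := fun x => (ENNReal.ofReal (-f x)).toReal) ?_ t), ← h0 t]
    · congr 1
      ext x
      rw [← sub_mul, ← Complex.ofReal_sub]
      congr 2
      rw [ENNReal.toReal_ofReal', ENNReal.toReal_ofReal']
      rcases le_total 0 (f x) with h | h
      · rw [max_eq_left h, max_eq_right (by linarith)]; ring
      · rw [max_eq_right h, max_eq_left (by linarith)]; ring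
    · simp only [ENNReal.toReal_ofReal']
      exact hf.pos_part
    · simp only [ENNReal.toReal_ofReal']
      exact hf.neg_part
  have := (withDensity_eq_iff hm.ennreal_ofReal hm'.ennreal_ofReal hfin₁).1 hν
  filter_upwards [this] with x hx
  have h := congrArg ENNReal.toReal hx
  rw [ENNReal.toReal_ofReal', ENNReal.toReal_ofReal'] at h
  rcases le_total 0 (f x) with h' | h'
  · rw [max_eq_left h', max_eq_right (by linarith)] at h; exact h
  · rw [max_eq_right h', max_eq_left (by linarith)] at h; simp only [Pi.zero_apply]; linarith

theorem integrable_mul_eval_gaussianReal {f : ℝ → ℝ} (hf : MemLp f 2 (gaussianReal 0 1))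
    (p : Polynomial ℝ) : Integrable (fun x => f x * p.eval x) (gaussianReal 0 1) :=
  hf.integrable_mul (memLp_eval_gaussianReal p)

/-- Functions orthogonal to all Hermite polynomials are orthogonal to all polynomials. -/
theorem integral_mul_eval_eq_zero_of_realHermite {f : ℝ → ℝ} (hf : MemLp f 2 (gaussianReal 0 1))
    (h0 : ∀ n : ℕ, ∫ x, f x * (realHermite n).eval x ∂gaussianReal 0 1 = 0)
    (p : Polynomial ℝ) : ∫ x, f x * p.eval x ∂gaussianReal 0 1 = 0 := by
  induction hd : p.natDegree using Nat.strong_induction_on generalizing p with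
  | _ n ih =>
    -- Cancelling the leading term with a monic Hermite polynomial lowers the degree without
    -- changing the integral.
    set q := p - Polynomial.C p.leadingCoeff * realHermite n with hq
    have hcoef : (realHermite n).coeff n = 1 := by
      have := (realHermite_monic n).coeff_natDegree
      rwa [natDegree_realHermite] at this
    have hpq : p = q + Polynomial.C p.leadingCoeff * realHermite n := by rw [hq]; ring
    have hsplit : ∫ x, f x * p.eval x ∂gaussianReal 0 1 = ∫ x, f x * q.eval x ∂gaussianReal 0 1 := by
      have e : (fun x => f x * p.eval x) = fun x => f x * q.eval x
          + p.leadingCoeff * (f x * (realHermite n).eval x) := by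
        ext x
        have := congrArg (Polynomial.eval x) hpq
        simp only [Polynomial.eval_add, Polynomial.eval_mul, Polynomial.eval_C] at this
        rw [this]; ring
      rw [e, integral_add (integrable_mul_eval_gaussianReal hf q)
        ((integrable_mul_eval_gaussianReal hf _).const_mul _), integral_const_mul, h0]
      ring
    rw [hsplit]
    by_cases hq0 : q = 0
    · simp [hq0]
    refine ih q.natDegree ?_ q rfl
    have hle : q.natDegree ≤ n := by
      refine (Polynomial.natDegree_sub_le _ _).trans (max_le hd.le ?_)
      exact (Polynomial.natDegree_C_mul_le _ _).trans (natDegree_realHermite n).le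
    refine lt_of_le_of_ne hle fun heq => hq0 ?_
    rw [← Polynomial.leadingCoeff_eq_zero, Polynomial.leadingCoeff, heq, hq]
    rw [Polynomial.coeff_sub, Polynomial.coeff_C_mul, hcoef, Polynomial.leadingCoeff, hd]
    ring

/-- Completeness of the Hermite polynomials in `L²` of the standard Gaussian. -/
theorem ae_eq_zero_of_realHermite {f : ℝ → ℝ} (hf : MemLp f 2 (gaussianReal 0 1))
    (h0 : ∀ n : ℕ, ∫ x, f x * (realHermite n).eval x ∂gaussianReal 0 1 = 0) :
    f =ᵐ[gaussianReal 0 1] 0 := by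
  refine ae_eq_zero_of_integral_mul_cexp_eq_zero (hf.integrable one_le_two) fun t => ?_
  refine integral_mul_cexp_eq_zero_of_moments hf (fun n => ?_) t
  simpa using integral_mul_eval_eq_zero_of_realHermite hf h0 (Polynomial.X ^ n)

/-- A function whose Hermite coefficients vanish from some index on is a.e. a polynomial. -/
theorem exists_ae_eq_eval_of_realHermite {f : ℝ → ℝ} (hf : MemLp f 2 (gaussianReal 0 1)) (R : ℕ)
    (h0 : ∀ n, R ≤ n → ∫ x, f x * (realHermite n).eval x ∂gaussianReal 0 1 = 0) :
    ∃ p : Polynomial ℝ, f =ᵐ[gaussianReal 0 1] fun x => p.eval x := by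
  set a : ℕ → ℝ := fun n => (∫ x, f x * (realHermite n).eval x ∂gaussianReal 0 1) / n.factorial
  set p : Polynomial ℝ := ∑ n ∈ Finset.range R, Polynomial.C (a n) * realHermite n with hp
  refine ⟨p, ?_⟩
  have hd : MemLp (fun x => f x - p.eval x) 2 (gaussianReal 0 1) :=
    hf.sub (memLp_eval_gaussianReal p)
  have := ae_eq_zero_of_realHermite hd fun n => ?_
  · filter_upwards [this] with x hx
    simpa [sub_eq_zero] using hx
  have hpn : ∫ x, p.eval x * (realHermite n).eval x ∂gaussianReal 0 1
      = ∫ x, f x * (realHermite n).eval x ∂gaussianReal 0 1 := by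
    have e : (fun x => p.eval x * (realHermite n).eval x) = fun x =>
        ∑ m ∈ Finset.range R, a m * ((realHermite m).eval x * (realHermite n).eval x) := by
      ext x
      simp only [hp, Polynomial.eval_finsetSum, Finset.sum_mul, Polynomial.eval_mul,
        Polynomial.eval_C, mul_assoc]
    rw [e, integral_finsetSum]
    · simp only [integral_const_mul]
      by_cases hn : n < R
      · rw [Finset.sum_eq_single n]
        · rw [integral_realHermite_mul_self]
          simp only [a]
          field_simp
        · intro m _ hmn
          rw [integral_realHermite_mul_of_ne hmn, mul_zero]
        · intro h; exact absurd (Finset.mem_range.2 hn) h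
      · rw [h0 n (by omega)]
        refine Finset.sum_eq_zero fun m hm => ?_
        rw [integral_realHermite_mul_of_ne (by have := Finset.mem_range.1 hm; omega), mul_zero]
    · intro m _
      have := (integrable_eval_gaussianReal (realHermite m * realHermite n)).const_mul (a m)
      simpa only [Polynomial.eval_mul] using this
  simp only [sub_mul]
  rw [integral_sub (integrable_mul_eval_gaussianReal hf _)
    (integrable_mul_eval_gaussianReal (memLp_eval_gaussianReal p) _), hpn, sub_self]

/-! ### Nonlinearity yields nonzero coefficients of high order -/

/-- A polynomial bounded by `|x|` for a.e. `x` is linear. -/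
theorem Polynomial.eq_C_mul_X_of_ae_abs_eval_le {p : Polynomial ℝ}
    (h : ∀ᵐ x : ℝ, |p.eval x| ≤ |x|) : ∃ a : ℝ, p = Polynomial.C a * Polynomial.X := by
  -- The inequality defines a closed set, and a set of full measure is dense.
  have hall : ∀ x : ℝ, |p.eval x| ≤ |x| := by
    have hc : IsClosed {x : ℝ | |p.eval x| ≤ |x|} :=
      isClosed_le (by fun_prop) (by fun_prop)
    have hd : Dense {x : ℝ | |p.eval x| ≤ |x|} := Measure.dense_of_ae h
    intro x
    have := hc.closure_eq ▸ hd x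
    exact this
  have hdeg : p.degree ≤ (Polynomial.X : Polynomial ℝ).degree := by
    by_contra! hlt
    have ht := Polynomial.abs_div_tendsto_atTop_atTop_of_degree_gt p Polynomial.X hlt
      Polynomial.X_ne_zero
    obtain ⟨x, hx⟩ := (ht.eventually_gt_atTop 1).exists
    rw [Polynomial.eval_X, abs_div] at hx
    exact absurd hx (not_lt.2 (div_le_one_of_le₀ (hall x) (abs_nonneg x)))
  rw [Polynomial.degree_X] at hdeg
  obtain hp := Polynomial.eq_X_add_C_of_degree_le_one hdeg
  have h0 : p.coeff 0 = 0 := by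
    have := hall 0
    rw [← Polynomial.coeff_zero_eq_eval_zero] at this
    simpa using this
  refine ⟨p.coeff 1, ?_⟩
  rw [h0] at hp
  simpa using hp

theorem exists_integral_mul_realHermite_ne_zero {σ : ℝ → ℝ}
    (hσL2 : MemLp σ 2 (gaussianReal 0 1))
    (hσnonlin : ¬ ∃ a : ℝ, σ =ᵐ[volume] fun t => a * t)
    (hσbound : ∀ t : ℝ, |σ t| ≤ |t|) (R : ℕ) :
    ∃ r, R ≤ r ∧ ∫ x, σ x * (realHermite r).eval x ∂gaussianReal 0 1 ≠ 0 := by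
  by_contra! hcon
  obtain ⟨p, hp⟩ := exists_ae_eq_eval_of_realHermite hσL2 R hcon
  have hp' : σ =ᵐ[volume] fun x => p.eval x :=
    (gaussianReal_absolutelyContinuous' 0 one_ne_zero).ae_le hp
  obtain ⟨a, rfl⟩ := Polynomial.eq_C_mul_X_of_ae_abs_eval_le (p := p) (by
    filter_upwards [hp'] with x hx
    rw [← hx]; exact hσbound x)
  exact hσnonlin ⟨a, by simpa using hp'⟩

/-! ### Inner products with an isotropic Gaussian vector -/

/-- The centred Gaussian measure on `ℝᵈ` with covariance `I / d`. -/
noncomputable abbrev isotropicGaussian (d : ℕ) : Measure (EuclideanSpace ℝ (Fin d)) :=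
  multivariateGaussian (0 : EuclideanSpace ℝ (Fin d)) ((d : ℝ)⁻¹ • (1 : Matrix (Fin d) (Fin d) ℝ))

theorem charFun_isotropicGaussian {d : ℕ} (u : EuclideanSpace ℝ (Fin d)) :
    charFun (isotropicGaussian d) u = Complex.exp (((-(‖u‖ ^ 2 / d) / 2 : ℝ) : ℂ)) := by
  have hS : ((d : ℝ)⁻¹ • (1 : Matrix (Fin d) (Fin d) ℝ)).PosSemidef :=
    Matrix.PosSemidef.one.smul (by positivity)
  rw [charFun_multivariateGaussian hS]
  congr 1
  have : u.ofLp ⬝ᵥ ((d : ℝ)⁻¹ • (1 : Matrix (Fin d) (Fin d) ℝ)) *ᵥ u.ofLp = ‖u‖ ^ 2 / d := by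
    rw [Matrix.smul_mulVec, Matrix.one_mulVec, dotProduct_smul, EuclideanSpace.real_norm_sq_eq]
    simp only [dotProduct, smul_eq_mul, ← sq]
    field_simp
  rw [this]
  simp only [inner_zero_right]
  push_cast
  ring

/-- Joint law of two coordinates of an isotropic Gaussian vector. -/
theorem map_inner_prod_isotropicGaussian {d : ℕ} (hd : d ≠ 0) {a b : EuclideanSpace ℝ (Fin d)}
    (ha : ‖a‖ ^ 2 = d) (hb : ‖b‖ ^ 2 = d) {ρ s : ℝ} (hρ : inner ℝ a b = d * ρ)
    (hs : ρ ^ 2 + s ^ 2 = 1) :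
    (isotropicGaussian d).map (fun w => ((inner ℝ a w : ℝ), (inner ℝ b w : ℝ)))
      = ((gaussianReal 0 1).prod (gaussianReal 0 1)).map
          (fun z : ℝ × ℝ => (z.1, ρ * z.1 + s * z.2)) := by
  have hd' : (d : ℝ) ≠ 0 := Nat.cast_ne_zero.2 hd
  have : IsProbabilityMeasure ((isotropicGaussian d).map
      (fun w => ((inner ℝ a w : ℝ), (inner ℝ b w : ℝ)))) :=
    Measure.isProbabilityMeasure_map (by fun_prop)
  have : IsProbabilityMeasure (((gaussianReal 0 1).prod (gaussianReal 0 1)).map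
          (fun z : ℝ × ℝ => (z.1, ρ * z.1 + s * z.2))) :=
    Measure.isProbabilityMeasure_map (by fun_prop)
  apply Measure.ext_of_charFunDual
  ext L
  set α := L (1, 0)
  set β := L (0, 1)
  have hL : ∀ x y : ℝ, L (x, y) = α * x + β * y := by
    intro x y
    have : ((x, y) : ℝ × ℝ) = x • ((1, 0) : ℝ × ℝ) + y • ((0, 1) : ℝ × ℝ) := by simp
    rw [this, map_add, map_smul, map_smul, smul_eq_mul, smul_eq_mul]
    ring
  rw [charFunDual_apply, charFunDual_apply, integral_map (by fun_prop) (by fun_prop),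
    integral_map (by fun_prop) (by fun_prop)]
  have h1 : ∫ w, Complex.exp (L (inner ℝ a w, inner ℝ b w) * Complex.I) ∂(isotropicGaussian d)
      = charFun (isotropicGaussian d) (α • a + β • b) := by
    rw [charFun_apply]
    congr 1
    ext w
    rw [hL, inner_add_right, real_inner_smul_right, real_inner_smul_right, real_inner_comm a,
      real_inner_comm b]
  have h2 : ∫ z : ℝ × ℝ, Complex.exp (L (z.1, ρ * z.1 + s * z.2) * Complex.I)
        ∂(gaussianReal 0 1).prod (gaussianReal 0 1)
      = charFun (gaussianReal 0 1) (α + β * ρ) * charFun (gaussianReal 0 1) (β * s) := by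
    rw [charFun_apply_real, charFun_apply_real, ← integral_prod_mul]
    congr 1
    ext z
    rw [hL, ← Complex.exp_add]
    congr 1
    push_cast
    ring
  rw [h1, h2, charFun_isotropicGaussian, charFun_gaussianReal, charFun_gaussianReal,
    ← Complex.exp_add]
  -- Both laws are centred Gaussian, so only their covariances have to match.
  have hn : ‖α • a + β • b‖ ^ 2 = d * ((α + β * ρ) ^ 2 + (β * s) ^ 2) := by
    rw [norm_add_sq_real, norm_smul, norm_smul, real_inner_smul_left, real_inner_smul_right, hρ,
      mul_pow, mul_pow, ha, hb, Real.norm_eq_abs, Real.norm_eq_abs, sq_abs, sq_abs]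
    linear_combination (-(d : ℝ) * β ^ 2) * hs
  rw [hn]
  congr 1
  have : (-(d * ((α + β * ρ) ^ 2 + (β * s) ^ 2) / d) / 2 : ℝ)
      = -((α + β * ρ) ^ 2 + (β * s) ^ 2) / 2 := by field_simp
  rw [this]
  push_cast
  ring

theorem measurePreserving_inner_isotropicGaussian {d : ℕ} (hd : d ≠ 0)
    {a : EuclideanSpace ℝ (Fin d)} (ha : ‖a‖ ^ 2 = d) :
    MeasurePreserving (fun w => (inner ℝ a w : ℝ)) (isotropicGaussian d) (gaussianReal 0 1) := by
  refine ⟨by fun_prop, ?_⟩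
  have h := map_inner_prod_isotropicGaussian hd ha ha (ρ := 1) (s := 0)
    (by rw [real_inner_self_eq_norm_sq, ha, mul_one]) (by norm_num)
  have h' := congrArg (Measure.map Prod.fst) h
  rw [Measure.map_map (by fun_prop) (by fun_prop), Measure.map_map (by fun_prop) (by fun_prop)] at h'
  refine h'.trans ?_
  change Measure.map Prod.fst _ = _
  simp

theorem memLp_comp_inner_isotropicGaussian {d : ℕ} (hd : d ≠ 0) {a : EuclideanSpace ℝ (Fin d)}
    (ha : ‖a‖ ^ 2 = d) {f : ℝ → ℝ} (hf : MemLp f 2 (gaussianReal 0 1)) :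
    MemLp (fun w => f (inner ℝ a w)) 2 (isotropicGaussian d) :=
  hf.comp_measurePreserving (measurePreserving_inner_isotropicGaussian hd ha)

/-- The pair of inner products is distributed as `(Z, ρ Z + s Z')` with `Z`, `Z'` independent
standard Gaussians; averaging over `Z'` first is the Mehler identity. -/
theorem integral_mul_realHermite_isotropicGaussian {d : ℕ} (hd : d ≠ 0)
    {a b : EuclideanSpace ℝ (Fin d)} (ha : ‖a‖ ^ 2 = d) (hb : ‖b‖ ^ 2 = d) {f : ℝ → ℝ}
    (hf : MemLp f 2 (gaussianReal 0 1)) (n : ℕ) :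
    ∫ w, f (inner ℝ a w) * (realHermite n).eval (inner ℝ b w) ∂isotropicGaussian d
      = (inner ℝ a b / d) ^ n * ∫ x, f x * (realHermite n).eval x ∂gaussianReal 0 1 := by
  have hd' : (0 : ℝ) < d := Nat.cast_pos.2 (Nat.pos_of_ne_zero hd)
  set ρ : ℝ := inner ℝ a b / d with hρ
  have hin : inner ℝ a b = d * ρ := by rw [hρ]; field_simp
  have hρ1 : ρ ^ 2 ≤ 1 := by
    have h := abs_real_inner_le_norm a b
    have h2 : (inner ℝ a b) ^ 2 ≤ (d : ℝ) ^ 2 := by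
      calc (inner ℝ a b) ^ 2 = |inner ℝ a b| ^ 2 := (sq_abs _).symm
        _ ≤ (‖a‖ * ‖b‖) ^ 2 := by gcongr
        _ = (d : ℝ) ^ 2 := by rw [mul_pow, ha, hb]; ring
    rw [hρ, div_pow]
    exact div_le_one_of_le₀ h2 (by positivity)
  set s : ℝ := √(1 - ρ ^ 2) with hs
  have hs1 : ρ ^ 2 + s ^ 2 = 1 := by
    rw [hs, Real.sq_sqrt (by linarith)]; ring
  have hmap := map_inner_prod_isotropicGaussian hd ha hb hin hs1
  set T : ℝ × ℝ → ℝ := fun z => f z.1 * (realHermite n).eval z.2 with hT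
  set A : EuclideanSpace ℝ (Fin d) → ℝ × ℝ := fun w => (inner ℝ a w, inner ℝ b w) with hA
  set B : ℝ × ℝ → ℝ × ℝ := fun z => (z.1, ρ * z.1 + s * z.2) with hB
  have hAm : Measurable A := by fun_prop
  have hBm : Measurable B := by fun_prop
  have hfst : Measure.map Prod.fst ((isotropicGaussian d).map A) = gaussianReal 0 1 := by
    rw [Measure.map_map (by fun_prop) hAm]
    exact (measurePreserving_inner_isotropicGaussian hd ha).map_eq
  have hTm : AEStronglyMeasurable T ((isotropicGaussian d).map A) := by
    refine AEStronglyMeasurable.mul ?_ (by fun_prop)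
    exact AEStronglyMeasurable.comp_measurable (f := Prod.fst) (hfst.symm ▸ hf.1) measurable_fst
  have hTi : Integrable T ((isotropicGaussian d).map A) := by
    rw [integrable_map_measure hTm hAm.aemeasurable]
    exact (memLp_comp_inner_isotropicGaussian hd ha hf).integrable_mul
      (memLp_comp_inner_isotropicGaussian hd hb (memLp_eval_gaussianReal _))
  have h1 : ∫ w, f (inner ℝ a w) * (realHermite n).eval (inner ℝ b w) ∂isotropicGaussian d
      = ∫ z, T z ∂(isotropicGaussian d).map A := (integral_map hAm.aemeasurable hTm).symm
  rw [h1]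
  rw [hmap] at hTm hTi ⊢
  rw [integral_map hBm.aemeasurable hTm]
  rw [integrable_map_measure hTm hBm.aemeasurable] at hTi
  rw [integral_prod (fun z => T (B z)) hTi, ← integral_const_mul]
  congr 1
  ext x
  simp only [hT, hB]
  rw [integral_const_mul, integral_realHermite_mehler hs1]
  ring

/-! ### Deterministic lower bound on the smallest eigenvalue -/

theorem le_minEigenvalue {N : ℕ} (hN : 1 ≤ N) {A : Matrix (Fin N) (Fin N) ℝ} (hA : A.IsHermitian)
    {b : ℝ} (h : ∀ v : Fin N → ℝ, b * ∑ i, v i ^ 2 ≤ v ⬝ᵥ A *ᵥ v) : b ≤ minEigenvalue A := by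
  have hspec := hA.spectrum_real_eq_range_eigenvalues
  have : Nonempty (Fin N) := ⟨⟨0, hN⟩⟩
  rw [minEigenvalue, hspec]
  refine le_csInf (Set.range_nonempty _) ?_
  rintro _ ⟨i, rfl⟩
  have h1 := h (hA.eigenvectorBasis i).ofLp
  have hnorm : ∑ j, (hA.eigenvectorBasis i).ofLp j ^ 2 = 1 := by
    have := EuclideanSpace.real_norm_sq_eq (hA.eigenvectorBasis i)
    rw [hA.eigenvectorBasis.orthonormal.1 i] at this
    simpa using this.symm
  rw [hnorm, mul_one] at h1
  have h2 := hA.eigenvalues_eq i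
  simp only [RCLike.re_to_real, star_trivial] at h2
  rwa [h2]

theorem sum_sum_mul_nonneg_of_gram {α : Type*} [MeasurableSpace α] {μ : Measure α} {N : ℕ}
    {F : Fin N → α → ℝ} (hF : ∀ i, MemLp (F i) 2 μ) (v : Fin N → ℝ) :
    0 ≤ ∑ i, ∑ j, v i * v j * ∫ w, F i w * F j w ∂μ := by
  have e : ∑ i, ∑ j, v i * v j * ∫ w, F i w * F j w ∂μ = ∫ w, (∑ i, v i * F i w) ^ 2 ∂μ := by
    have e1 : ∀ w, (∑ i, v i * F i w) ^ 2 = ∑ i, ∑ j, v i * v j * (F i w * F j w) := by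
      intro w
      rw [sq, Finset.sum_mul_sum]
      refine Finset.sum_congr rfl fun i _ => Finset.sum_congr rfl fun j _ => by ring
    have hi : ∀ i j, Integrable (fun w => v i * v j * (F i w * F j w)) μ :=
      fun i j => ((hF i).integrable_mul (hF j)).const_mul _
    simp only [e1]
    rw [integral_finsetSum _ fun i _ => integrable_finsetSum _ fun j _ => hi i j]
    refine Finset.sum_congr rfl fun i _ => ?_
    rw [integral_finsetSum _ fun j _ => hi i j]
    exact Finset.sum_congr rfl fun j _ => (integral_const_mul _ _).symm
  rw [e]
  exact integral_nonneg fun w => sq_nonneg _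

theorem expectedGram_dataMatrix_apply (σ : ℝ → ℝ) {N d : ℕ}
    (x : Fin N → EuclideanSpace ℝ (Fin d)) (i j : Fin N) :
    expectedGram σ (dataMatrix x) i j
      = ∫ w, σ (inner ℝ (x i) w) * σ (inner ℝ (x j) w) ∂isotropicGaussian d := by
  have h : ∀ (l : Fin N) (w : EuclideanSpace ℝ (Fin d)),
      (dataMatrix x *ᵥ WithLp.ofLp w) l = inner ℝ (x l) w := by
    intro l w
    simp [dataMatrix, Matrix.mulVec, dotProduct, PiLp.inner_apply, mul_comm]
  simp only [expectedGram, Matrix.of_apply, Matrix.vecMulVec_apply, h]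

theorem integral_sub_mul_mul_sub_mul {α : Type*} [MeasurableSpace α] {μ : Measure α}
    {f₁ f₂ h₁ h₂ : α → ℝ} (hf₁ : MemLp f₁ 2 μ) (hf₂ : MemLp f₂ 2 μ) (hh₁ : MemLp h₁ 2 μ)
    (hh₂ : MemLp h₂ 2 μ) (c : ℝ) :
    ∫ w, (f₁ w - c * h₁ w) * (f₂ w - c * h₂ w) ∂μ
      = ∫ w, f₁ w * f₂ w ∂μ - c * ∫ w, f₁ w * h₂ w ∂μ - c * ∫ w, f₂ w * h₁ w ∂μ
        + c ^ 2 * ∫ w, h₁ w * h₂ w ∂μ := by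
  have i1 : Integrable (fun w => f₁ w * f₂ w) μ := hf₁.integrable_mul hf₂
  have i2 : Integrable (fun w => c * (f₁ w * h₂ w)) μ := (hf₁.integrable_mul hh₂).const_mul c
  have i3 : Integrable (fun w => c * (f₂ w * h₁ w)) μ := (hf₂.integrable_mul hh₁).const_mul c
  have i4 : Integrable (fun w => c ^ 2 * (h₁ w * h₂ w)) μ :=
    (hh₁.integrable_mul hh₂).const_mul (c ^ 2)
  have i12 : Integrable (fun w => f₁ w * f₂ w - c * (f₁ w * h₂ w)) μ := i1.sub i2
  have i123 : Integrable (fun w => f₁ w * f₂ w - c * (f₁ w * h₂ w) - c * (f₂ w * h₁ w)) μ :=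
    i12.sub i3
  have e : (fun w => (f₁ w - c * h₁ w) * (f₂ w - c * h₂ w))
      = fun w => f₁ w * f₂ w - c * (f₁ w * h₂ w) - c * (f₂ w * h₁ w)
        + c ^ 2 * (h₁ w * h₂ w) := by
    ext w; ring
  rw [e, integral_add i123 i4, integral_sub i12 i3, integral_sub i1 i2, integral_const_mul,
    integral_const_mul, integral_const_mul]

/-- Bessel's inequality: the expected Gram matrix dominates each Hermite component. -/
theorem sum_sum_inner_pow_le_expectedGram {σ : ℝ → ℝ} (hσ : MemLp σ 2 (gaussianReal 0 1))
    {N d : ℕ} (hd : d ≠ 0) {x : Fin N → EuclideanSpace ℝ (Fin d)} (hx : ∀ i, ‖x i‖ ^ 2 = d)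
    (r : ℕ) (v : Fin N → ℝ) :
    (∫ t, σ t * (realHermite r).eval t ∂gaussianReal 0 1) ^ 2 / r.factorial
        * ∑ i, ∑ j, v i * v j * (inner ℝ (x i) (x j) / d) ^ r
      ≤ v ⬝ᵥ expectedGram σ (dataMatrix x) *ᵥ v := by
  set m : ℝ := ∫ t, σ t * (realHermite r).eval t ∂gaussianReal 0 1 with hm
  -- Coefficient of the projection of `σ` onto the `r`-th Hermite polynomial. The Gram matrix of the
  -- residuals is then exactly the difference of the two sides.
  set c : ℝ := m / r.factorial with hc
  have hfac : (r.factorial : ℝ) ≠ 0 := Nat.cast_ne_zero.2 r.factorial_ne_zero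
  have hh := memLp_eval_gaussianReal (realHermite r)
  have hS : ∀ i, MemLp (fun w => σ (inner ℝ (x i) w)) 2 (isotropicGaussian d) :=
    fun i => memLp_comp_inner_isotropicGaussian hd (hx i) hσ
  have hH : ∀ i, MemLp (fun w => (realHermite r).eval (inner ℝ (x i) w)) 2 (isotropicGaussian d) :=
    fun i => memLp_comp_inner_isotropicGaussian hd (hx i) hh
  have hF : ∀ i, MemLp (fun w => σ (inner ℝ (x i) w)
      - c * (realHermite r).eval (inner ℝ (x i) w)) 2 (isotropicGaussian d) :=
    fun i => (hS i).sub ((hH i).const_mul c)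
  have hD : ∀ i j, ∫ w, (σ (inner ℝ (x i) w) - c * (realHermite r).eval (inner ℝ (x i) w))
        * (σ (inner ℝ (x j) w) - c * (realHermite r).eval (inner ℝ (x j) w)) ∂isotropicGaussian d
      = expectedGram σ (dataMatrix x) i j
        - m ^ 2 / r.factorial * (inner ℝ (x i) (x j) / d) ^ r := by
    intro i j
    rw [integral_sub_mul_mul_sub_mul (hS i) (hS j) (hH i) (hH j),
      integral_mul_realHermite_isotropicGaussian hd (hx i) (hx j) hσ,
      integral_mul_realHermite_isotropicGaussian hd (hx j) (hx i) hσ,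
      integral_mul_realHermite_isotropicGaussian hd (hx i) (hx j) hh,
      integral_realHermite_mul_self, expectedGram_dataMatrix_apply, real_inner_comm (x i) (x j),
      ← hm, hc]
    field_simp
    ring
  have key := sum_sum_mul_nonneg_of_gram hF v
  simp only [hD] at key
  simp only [mul_sub, Finset.sum_sub_distrib] at key
  have e2 : v ⬝ᵥ expectedGram σ (dataMatrix x) *ᵥ v
      = ∑ i, ∑ j, v i * v j * expectedGram σ (dataMatrix x) i j := by
    simp only [dotProduct, Matrix.mulVec, Finset.mul_sum]
    exact Finset.sum_congr rfl fun i _ => Finset.sum_congr rfl fun j _ => by ring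
  rw [e2, Finset.mul_sum]
  simp only [Finset.mul_sum]
  refine le_trans (le_of_eq ?_) (sub_nonneg.1 key)
  exact Finset.sum_congr rfl fun i _ => Finset.sum_congr rfl fun j _ => by ring

theorem half_sum_sq_le_of_small_offDiag {N : ℕ} {R : Fin N → Fin N → ℝ} {ε : ℝ} (hε : 0 ≤ ε)
    (hN : N * ε ≤ 1 / 2) (hdiag : ∀ i, R i i = 1) (hoff : ∀ i j, i ≠ j → |R i j| ≤ ε)
    (v : Fin N → ℝ) : 1 / 2 * ∑ i, v i ^ 2 ≤ ∑ i, ∑ j, v i * v j * R i j := by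
  -- The loss `ε |v i| |v j|` is allowed on the diagonal too, so that the losses sum to `ε (Σ |v
  -- i|)²`, which Cauchy–Schwarz bounds by `N ε Σ (v i)²`.
  have hterm : ∀ i j, (if i = j then v i ^ 2 else 0) - ε * (|v i| * |v j|) ≤ v i * v j * R i j := by
    intro i j
    by_cases hij : i = j
    · subst hij
      rw [if_pos rfl, hdiag, mul_one]
      nlinarith [mul_nonneg hε (mul_nonneg (abs_nonneg (v i)) (abs_nonneg (v i)))]
    · rw [if_neg hij]
      have h1 : |v i * v j * R i j| ≤ |v i| * |v j| * ε := by
        rw [abs_mul, abs_mul]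
        exact mul_le_mul_of_nonneg_left (hoff i j hij) (by positivity)
      linarith [neg_abs_le (v i * v j * R i j)]
  have hsum := Finset.sum_le_sum fun i (_ : i ∈ Finset.univ) =>
    Finset.sum_le_sum fun j (_ : j ∈ Finset.univ) => hterm i j
  refine le_trans ?_ hsum
  simp only [Finset.sum_sub_distrib, Finset.sum_ite_eq, Finset.mem_univ, if_true,
    ← Finset.mul_sum]
  rw [← Finset.sum_mul]
  have hcs := sq_sum_le_card_mul_sum_sq (s := (Finset.univ : Finset (Fin N))) (f := fun i => |v i|)
  simp only [Finset.card_univ, Fintype.card_fin, sq_abs] at hcs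
  have h0 : 0 ≤ ∑ i, v i ^ 2 := Finset.sum_nonneg fun i _ => sq_nonneg _
  have h1 := mul_le_mul_of_nonneg_left hcs hε
  have h2 := mul_le_mul_of_nonneg_right hN h0
  rw [← sq]
  linarith [h1, h2]

theorem le_lambdaStar_of_inner_pow_le {σ : ℝ → ℝ} (hσ : MemLp σ 2 (gaussianReal 0 1))
    {N d : ℕ} (hN : 1 ≤ N) (hd : d ≠ 0) {x : Fin N → EuclideanSpace ℝ (Fin d)}
    (hx : ∀ i, ‖x i‖ ^ 2 = d) (r : ℕ) {ε : ℝ} (hε : 0 ≤ ε) (hNε : N * ε ≤ 1 / 2)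
    (hoff : ∀ i j, i ≠ j → |inner ℝ (x i) (x j) / d| ^ r ≤ ε) :
    (∫ t, σ t * (realHermite r).eval t ∂gaussianReal 0 1) ^ 2 / (2 * r.factorial)
      ≤ lambdaStar σ (dataMatrix x) := by
  refine le_minEigenvalue hN ?_ fun v => ?_
  · refine Matrix.IsHermitian.ext fun i j => ?_
    simp only [star_trivial, expectedGram_dataMatrix_apply, mul_comm]
  · refine le_trans ?_ (sum_sum_inner_pow_le_expectedGram hσ hd hx r v)
    have h := half_sum_sq_le_of_small_offDiag
      (R := fun i j => (inner ℝ (x i) (x j) / d) ^ r) hε hNε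
      (fun i => by
        rw [real_inner_self_eq_norm_sq, hx, div_self (Nat.cast_ne_zero.2 hd), one_pow])
      (fun i j hij => by rw [abs_pow]; exact hoff i j hij) v
    have h2 := mul_le_mul_of_nonneg_left h (show 0 ≤
      (∫ t, σ t * (realHermite r).eval t ∂gaussianReal 0 1) ^ 2 / r.factorial by positivity)
    refine le_trans (le_of_eq ?_) h2
    field_simp

/-! ### Sub-Gaussian tails and the union bound -/

/-- Sub-Gaussian tail bound from the `ψ₂` norm. -/
theorem measure_le_abs_of_psi2Norm_le {Ω : Type*} [MeasurableSpace Ω] {P : Measure Ω} {Y : Ω → ℝ}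
    (hY : AEMeasurable Y P) {c : ℝ} (hc : 0 < c) (h : psi2Norm P Y ≤ ENNReal.ofReal c) {t : ℝ}
    (ht : 0 ≤ t) :
    P {ω | t ≤ |Y ω|} ≤ ENNReal.ofReal (2 * Real.exp (-(t ^ 2 / (2 * c ^ 2)))) := by
  -- The infimum need not be known to be attained; the slack `√2` yields an admissible `K` with `K²
  -- ≤ 2 c²`, then Markov's inequality applies.
  have hlt : psi2Norm P Y < ENNReal.ofReal (√2 * c) := by
    refine h.trans_lt ((ENNReal.ofReal_lt_ofReal_iff (by positivity)).2 ?_)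
    have : (1 : ℝ) < √2 := Real.lt_sqrt_of_sq_lt (by norm_num)
    nlinarith
  simp only [psi2Norm, iInf_lt_iff] at hlt
  obtain ⟨K, ⟨hK, hint⟩, hKc⟩ := hlt
  have hKc' : K < √2 * c := (ENNReal.ofReal_lt_ofReal_iff (by positivity)).1 hKc
  have hK2 : K ^ 2 ≤ 2 * c ^ 2 := by
    calc K ^ 2 ≤ (√2 * c) ^ 2 := by gcongr
      _ = 2 * c ^ 2 := by rw [mul_pow, Real.sq_sqrt (by norm_num)]
  set e : ℝ≥0∞ := ENNReal.ofReal (Real.exp (t ^ 2 / (2 * c ^ 2))) with he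
  have hmk := mul_meas_ge_le_lintegral₀ (μ := P)
    (f := fun ω => ENNReal.ofReal (Real.exp (Y ω ^ 2 / K ^ 2))) (by fun_prop) e
  have hsub : {ω | t ≤ |Y ω|} ⊆ {ω | e ≤ ENNReal.ofReal (Real.exp (Y ω ^ 2 / K ^ 2))} := by
    intro ω hω
    refine ENNReal.ofReal_le_ofReal (Real.exp_le_exp.2 ?_)
    have h1 : t ^ 2 ≤ Y ω ^ 2 := by
      rw [← sq_abs (Y ω)]
      exact pow_le_pow_left₀ ht hω 2
    gcongr
  have h2 : e * P {ω | t ≤ |Y ω|} ≤ 2 :=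
    (mul_le_mul_right (measure_mono hsub) e).trans (hmk.trans hint)
  have he0 : e ≠ 0 := by simp [he, Real.exp_pos]
  have he1 : e ≠ ∞ := ENNReal.ofReal_ne_top
  have h3 : P {ω | t ≤ |Y ω|} ≤ 2 / e := by
    rw [ENNReal.le_div_iff_mul_le (Or.inl he0) (Or.inl he1), mul_comm]
    exact h2
  refine h3.trans (le_of_eq ?_)
  rw [Real.exp_neg, ← div_eq_mul_inv, ENNReal.ofReal_div_of_pos (Real.exp_pos _)]
  simp [he]

/-- Two independent sub-Gaussian vectors, one of which lies on the sphere of radius `√d`, are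
nearly orthogonal. -/
theorem measure_le_abs_inner_div_of_indepFun {Ω : Type*} [MeasurableSpace Ω] {P : Measure Ω}
    [IsProbabilityMeasure P] {d : ℕ} (hd : d ≠ 0) {x y : Ω → EuclideanSpace ℝ (Fin d)}
    (hx : AEMeasurable x P) (hy : AEMeasurable y P) (hxy : IndepFun x y P)
    (hnorm : ∀ᵐ ω ∂P, ‖y ω‖ = √(d : ℝ)) {c : ℝ} (hc : 0 < c)
    (hpsi : vectorPsi2Norm P x ≤ ENNReal.ofReal c) {τ : ℝ} (hτ : 0 ≤ τ) :
    P {ω | τ ≤ |inner ℝ (x ω) (y ω) / d|}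
      ≤ ENNReal.ofReal (2 * Real.exp (-(τ ^ 2 * d / (2 * c ^ 2)))) := by
  have hd' : (0 : ℝ) < d := Nat.cast_pos.2 (Nat.pos_of_ne_zero hd)
  set B : ℝ≥0∞ := ENNReal.ofReal (2 * Real.exp (-(τ ^ 2 * d / (2 * c ^ 2)))) with hB
  set S : Set (EuclideanSpace ℝ (Fin d) × EuclideanSpace ℝ (Fin d)) :=
    {z | τ ≤ |inner ℝ z.1 z.2 / d|} with hS
  have hSm : MeasurableSet S := measurableSet_le (by fun_prop) (by fun_prop)
  have hprod := (indepFun_iff_map_prod_eq_prod_map_map hx hy).1 hxy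
  have : IsProbabilityMeasure (P.map x) := Measure.isProbabilityMeasure_map hx
  have : IsProbabilityMeasure (P.map y) := Measure.isProbabilityMeasure_map hy
  have h1 : P {ω | τ ≤ |inner ℝ (x ω) (y ω) / d|} = (P.map fun ω => (x ω, y ω)) S := by
    rw [Measure.map_apply_of_aemeasurable (hx.prodMk hy) hSm]
    rfl
  rw [h1, hprod, Measure.prod_apply_symm hSm]
  have hae : ∀ᵐ z ∂P.map y, ‖z‖ = √(d : ℝ) :=
    (ae_map_iff hy (measurableSet_eq_fun (by fun_prop) (by fun_prop))).2 hnorm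
  -- Independence allows `y` to be frozen at `z`; the `ψ₂` bound on `x` is used in the unit
  -- direction `z / √d`.
  have hle : ∀ᵐ z ∂P.map y, P.map x ((fun v => (v, z)) ⁻¹' S) ≤ B := by
    filter_upwards [hae] with z hz
    have hsq : (0 : ℝ) < √(d : ℝ) := Real.sqrt_pos.2 hd'
    set u : EuclideanSpace ℝ (Fin d) := (√(d : ℝ))⁻¹ • z with hu
    have hu1 : ‖u‖ = 1 := by
      rw [hu, norm_smul, norm_inv, Real.norm_of_nonneg hsq.le, hz, inv_mul_cancel₀ hsq.ne']
    have hY : psi2Norm P (fun ω => inner ℝ (x ω) u) ≤ ENNReal.ofReal c :=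
      (le_iSup₂ (f := fun (u : EuclideanSpace ℝ (Fin d)) (_ : ‖u‖ = 1) =>
        psi2Norm P fun ω => inner ℝ (x ω) u) u hu1).trans hpsi
    have ht := measure_le_abs_of_psi2Norm_le (P := P) (Y := fun ω => inner ℝ (x ω) u)
      (hx.inner aemeasurable_const) hc hY (t := τ * √(d : ℝ)) (by positivity)
    rw [mul_pow, Real.sq_sqrt hd'.le] at ht
    rw [Measure.map_apply_of_aemeasurable hx (measurable_prodMk_right hSm)]
    refine (measure_mono fun ω hω => ?_).trans ht
    have hω' : τ ≤ |inner ℝ (x ω) z / d| := hω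
    change τ * √(d : ℝ) ≤ |inner ℝ (x ω) u|
    have e : inner ℝ (x ω) u = (inner ℝ (x ω) z / d) * √(d : ℝ) := by
      rw [hu, real_inner_smul_right]
      have := Real.mul_self_sqrt hd'.le
      field_simp
      rw [sq, this, mul_comm]
    rw [e, abs_mul, abs_of_pos hsq]
    exact mul_le_mul_of_nonneg_right hω' hsq.le
  calc ∫⁻ z, P.map x ((fun v => (v, z)) ⁻¹' S) ∂P.map y ≤ ∫⁻ _, B ∂P.map y :=
        lintegral_mono_ae hle
    _ = B := by simp

/-- Lower tail of `λ_*` in terms of a single Hermite coefficient of `σ`. -/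
theorem one_sub_le_measureReal_le_lambdaStar {σ : ℝ → ℝ} (hσ : MemLp σ 2 (gaussianReal 0 1))
    {N d : ℕ} (hN : 1 ≤ N) (hd : d ≠ 0) {Ω : Type*} [MeasurableSpace Ω] {P : Measure Ω}
    [IsProbabilityMeasure P] {x : Fin N → Ω → EuclideanSpace ℝ (Fin d)}
    (hx : ∀ i, AEMeasurable (x i) P) (hindep : iIndepFun x P)
    (hnorm : ∀ i, ∀ᵐ ω ∂P, ‖x i ω‖ = √(d : ℝ)) {c : ℝ} (hc : 0 < c)
    (hpsi : ∀ i, vectorPsi2Norm P (x i) ≤ ENNReal.ofReal c) (r : ℕ) {τ : ℝ} (hτ : 0 ≤ τ)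
    (hNτ : N * τ ^ r ≤ 1 / 2) :
    1 - 2 * (N : ℝ) ^ 2 * Real.exp (-(τ ^ 2 * d / (2 * c ^ 2)))
      ≤ P.real {ω | (∫ t, σ t * (realHermite r).eval t ∂gaussianReal 0 1) ^ 2 / (2 * r.factorial)
          ≤ lambdaStar σ (dataMatrix fun i => x i ω)} := by
  set S : Set Ω := {ω | (∫ t, σ t * (realHermite r).eval t ∂gaussianReal 0 1) ^ 2
    / (2 * r.factorial) ≤ lambdaStar σ (dataMatrix fun i => x i ω)} with hS
  set D : Fin N → Fin N → Set Ω := fun i j =>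
    {ω | i ≠ j ∧ τ ≤ |inner ℝ (x i ω) (x j ω) / d|} with hD
  set E : ℝ := Real.exp (-(τ ^ 2 * d / (2 * c ^ 2))) with hE
  have hDle : ∀ i j, P (D i j) ≤ ENNReal.ofReal (2 * E) := by
    intro i j
    by_cases hij : i = j
    · simp [hD, hij]
    · refine (measure_mono fun ω hω => hω.2).trans
        (measure_le_abs_inner_div_of_indepFun hd (hx i) (hx j) (hindep.indepFun hij) (hnorm j) hc
          (hpsi i) hτ)
  have hcov : Sᶜ ≤ᵐ[P] ⋃ i, ⋃ j, D i j := by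
    filter_upwards [ae_all_iff.2 hnorm] with ω hω hωS
    by_contra hcon
    refine hωS ?_
    have hcon' : ∀ i j, i ≠ j → |inner ℝ (x i ω) (x j ω) / d| < τ := by
      intro i j hij
      by_contra! hge
      exact hcon (Set.mem_iUnion.2 ⟨i, Set.mem_iUnion.2 ⟨j, hij, hge⟩⟩)
    exact le_lambdaStar_of_inner_pow_le hσ hN hd (x := fun i => x i ω)
      (fun i => by rw [hω i, Real.sq_sqrt (Nat.cast_nonneg d)]) r (pow_nonneg hτ r) hNτ
      fun i j hij => pow_le_pow_left₀ (abs_nonneg _) (hcon' i j hij).le r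
  have hSc : P Sᶜ ≤ ENNReal.ofReal (2 * (N : ℝ) ^ 2 * E) := by
    calc P Sᶜ ≤ P (⋃ i, ⋃ j, D i j) := measure_mono_ae hcov
      _ ≤ ∑ i, P (⋃ j, D i j) := measure_iUnion_fintype_le P _
      _ ≤ ∑ i, ∑ j, P (D i j) := Finset.sum_le_sum fun i _ => measure_iUnion_fintype_le P _
      _ ≤ ∑ _i : Fin N, ∑ _j : Fin N, ENNReal.ofReal (2 * E) :=
        Finset.sum_le_sum fun i _ => Finset.sum_le_sum fun j _ => hDle i j
      _ = ENNReal.ofReal (2 * (N : ℝ) ^ 2 * E) := by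
        simp only [Finset.sum_const, Finset.card_univ, Fintype.card_fin, nsmul_eq_mul]
        rw [← mul_assoc, ← ENNReal.ofReal_natCast, ← ENNReal.ofReal_mul (by positivity),
          ← ENNReal.ofReal_mul (by positivity)]
        congr 1
        ring
  have hSc' : P.real Sᶜ ≤ 2 * (N : ℝ) ^ 2 * E :=
    ENNReal.toReal_le_of_le_ofReal (by positivity) hSc
  -- Subadditivity suffices here, so measurability of `S` is not needed.
  have hone : (1 : ℝ) ≤ P.real S + P.real Sᶜ := by
    have := measureReal_union_le (μ := P) S Sᶜ
    rwa [Set.union_compl_self, probReal_univ] at this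
  linarith

/-! ### Choice of exponents and conclusion -/

/-- Since `d ≥ N^(1/k)` and `2/r ≤ 1/(5k)`, the surviving power of `N` is `1/k - 1/(5k) = 4/(5k)`;
the factor `2^(-2/r)` costs at most `1/2`. -/
theorem rpow_four_fifths_le_of_le_pow {N d k r : ℕ} (hN : 1 ≤ N) (hk : k ≠ 0) (hNd : N ≤ d ^ k)
    (hr : 10 * k ≤ r) :
    (N : ℝ) ^ ((4 : ℝ) / (5 * (k : ℝ))) / 2 ≤ ((2 * N : ℝ) ^ (-(1 : ℝ) / r)) ^ 2 * d := by
  have hN1 : (1 : ℝ) ≤ N := Nat.one_le_cast.2 hN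
  have hN0 : (0 : ℝ) < N := by linarith
  have hk1 : (1 : ℝ) ≤ k := Nat.one_le_cast.2 (Nat.one_le_iff_ne_zero.2 hk)
  have hr1 : 10 * (k : ℝ) ≤ r := by exact_mod_cast hr
  have hr0 : (0 : ℝ) < r := by linarith
  have hd : (N : ℝ) ^ ((1 : ℝ) / k) ≤ d := by
    have h1 : (N : ℝ) ≤ (d : ℝ) ^ k := by exact_mod_cast hNd
    calc (N : ℝ) ^ ((1 : ℝ) / k) ≤ ((d : ℝ) ^ k) ^ ((1 : ℝ) / k) := by gcongr
      _ = d := by rw [one_div, Real.pow_rpow_inv_natCast (Nat.cast_nonneg d) hk]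
  have e1 : ((2 * N : ℝ) ^ (-(1 : ℝ) / r)) ^ 2 = (2 : ℝ) ^ (-(2 : ℝ) / r) * N ^ (-(2 : ℝ) / r) := by
    rw [← Real.mul_rpow (by norm_num) hN0.le, ← Real.rpow_natCast, ← Real.rpow_mul (by positivity)]
    congr 1
    push_cast
    ring
  have h2 : (1 : ℝ) / 2 ≤ (2 : ℝ) ^ (-(2 : ℝ) / r) := by
    rw [one_div, ← Real.rpow_neg_one]
    refine Real.rpow_le_rpow_of_exponent_le (by norm_num) ?_
    rw [le_div_iff₀ hr0]
    linarith
  have h3 : (N : ℝ) ^ (-(1 : ℝ) / (5 * k)) ≤ N ^ (-(2 : ℝ) / r) := by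
    refine Real.rpow_le_rpow_of_exponent_le hN1 ?_
    rw [neg_div, neg_div, neg_le_neg_iff, div_le_div_iff₀ hr0 (by positivity)]
    linarith
  have e4 : (N : ℝ) ^ ((4 : ℝ) / (5 * (k : ℝ)))
      = N ^ (-(1 : ℝ) / (5 * k)) * (N : ℝ) ^ ((1 : ℝ) / k) := by
    rw [← Real.rpow_add hN0]
    congr 1
    field_simp
    norm_num
  calc (N : ℝ) ^ ((4 : ℝ) / (5 * (k : ℝ))) / 2
      = 1 / 2 * N ^ (-(1 : ℝ) / (5 * k)) * (N : ℝ) ^ ((1 : ℝ) / k) := by rw [e4]; ring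
    _ ≤ (2 : ℝ) ^ (-(2 : ℝ) / r) * N ^ (-(2 : ℝ) / r) * d := by gcongr
    _ = _ := by rw [e1]

theorem theorem3p2 (c₁ : ℝ) (hc₁ : 0 < c₁) (σ : ℝ → ℝ)
    (hσL2 : MemLp σ 2 (gaussianReal 0 1))
    (hσnonlin : ¬ ∃ a : ℝ, σ =ᵐ[volume] fun t => a * t)
    (hσbound : ∀ t : ℝ, |σ t| ≤ |t|) :
    ∃ c₂ : ℝ, 0 < c₂ ∧ ∀ k : ℕ, 2 ≤ k → ∃ b₁ : ℝ, 0 < b₁ ∧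
      ∀ N d : ℕ, 1 ≤ N → N ≤ d ^ k →
      ∀ (Ω : Type*) [MeasurableSpace Ω] (P : Measure Ω) [IsProbabilityMeasure P]
        (x : Fin N → Ω → EuclideanSpace ℝ (Fin d)),
        iIndepFun x P →
        (∀ i j, IdentDistrib (x i) (x j) P P) →
        (∀ i, ∀ᵐ ω ∂P, ‖x i ω‖ = √(d : ℝ)) →
        (∀ i, vectorPsi2Norm P (x i) ≤ ENNReal.ofReal c₁) →
        1 - 2 * (N : ℝ) ^ 2 * Real.exp (-c₂ * (N : ℝ) ^ ((4 : ℝ) / (5 * (k : ℝ))))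
          ≤ P.real {ω | b₁ ≤ lambdaStar σ (dataMatrix fun i => x i ω)} := by
  -- The tail exponent `1 / (2 c₁²)` times the factor `1/2` lost in `rpow_four_fifths_le_of_le_pow`.
  refine ⟨1 / (4 * c₁ ^ 2), by positivity, fun k hk => ?_⟩
  obtain ⟨r, hr, hne⟩ := exists_integral_mul_realHermite_ne_zero hσL2 hσnonlin hσbound (10 * k)
  refine ⟨(∫ t, σ t * (realHermite r).eval t ∂gaussianReal 0 1) ^ 2 / (2 * r.factorial),
    by positivity, fun N d hN hNd Ω _ P _ x hindep hident hnorm hpsi => ?_⟩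
  have hd : d ≠ 0 := by
    rintro rfl
    rw [zero_pow (by omega)] at hNd
    omega
  have hN0 : (0 : ℝ) < N := Nat.cast_pos.2 hN
  have hr0 : (r : ℝ) ≠ 0 := Nat.cast_ne_zero.2 (by omega)
  -- The threshold for which `N τ^r` equals `1/2`.
  set τ : ℝ := (2 * N : ℝ) ^ (-(1 : ℝ) / r) with hτ
  have hNτ : N * τ ^ r ≤ 1 / 2 := by
    have : τ ^ r = (2 * N : ℝ)⁻¹ := by
      rw [hτ, ← Real.rpow_natCast, ← Real.rpow_mul (by positivity), div_mul_cancel₀ _ hr0,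
        Real.rpow_neg_one]
    rw [this]
    exact le_of_eq (by field_simp)
  refine le_trans ?_ (one_sub_le_measureReal_le_lambdaStar hσL2 hN hd
    (fun i => (hident i i).aemeasurable_fst) hindep hnorm hc₁ hpsi r (τ := τ) (by positivity) hNτ)
  have hexp : -(τ ^ 2 * d / (2 * c₁ ^ 2))
      ≤ -(1 / (4 * c₁ ^ 2)) * (N : ℝ) ^ ((4 : ℝ) / (5 * (k : ℝ))) := by
    have h := rpow_four_fifths_le_of_le_pow hN (by omega) hNd hr
    have h2 := div_le_div_of_nonneg_right h (show 0 ≤ 2 * c₁ ^ 2 by positivity)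
    have e : (1 / (4 * c₁ ^ 2)) * (N : ℝ) ^ ((4 : ℝ) / (5 * (k : ℝ)))
        = (N : ℝ) ^ ((4 : ℝ) / (5 * (k : ℝ))) / 2 / (2 * c₁ ^ 2) := by
      field_simp
      ring
    rw [neg_mul, e]
    exact neg_le_neg h2
  have := mul_le_mul_of_nonneg_left (Real.exp_le_exp.2 hexp)
    (show (0 : ℝ) ≤ 2 * (N : ℝ) ^ 2 by positivity)
  linarith
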